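/- Let $n\ge 2$. For a bounded set $\mathscr M\subset M_n(\mathbb R)$ consider the linear switched system $(\Sigma_{\mathscr M})$: $\dot x(t)=A(t)x(t)$, $t\ge 0$, where the switching law $A:[0,\infty)\to\mathscr M$ is an arbitrary measurable function, and let $\Phi_A(t,0)$ be the associated fundamental matrix ($\Phi_A(0,0)=\mathrm{Id}$). The system is uniformly exponentially stable if there are $C,\gamma>0$ such that $\|\Phi_A(t,0)\|\le Ce^{-\gamma t}$ for every switching law $A$ and every $t\ge0$. A common Lyapunov function for $(\Sigma_{\mathscr M})$ is a continuous function $V:\mathbb R^n\to\mathbb R$ with $V(0)=0$ and $V(x)>0$ for $x\ne0$ which is strictly decreasing along every nonzero trajectory of $(\Sigma_{\mathscr M})$. A set $\mathcal P$ of functions $\mathbb R^n\to\mathbb R$ is universal if for every bounded $\mathscr M\subset M_n(\mathbb R)$ such that $(\Sigma_{\mathscr M})$ is uniformly exponentially stable, there is a common Lyapunov function for $(\Sigma_{\mathscr M})$ in $\mathcal P$. Let $d\ge 0$ and $l\ge1$ be integers, and let $\mathcal P^n_{d,l}$ be the set of continuous functions $V:\mathbb R^n\to\mathbb R$ for which there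 exist real polynomials $V_1,\dots,V_l$ in $n$ variables (depending on $V$) of degree at most $d$ with $V(x)\in\{V_1(x),\dots,V_l(x)\}$ for every $x\in\mathbb R^n$. Then $\mathcal P^n_{d,l}$ is not universal. In particular, for every integer $N\ge1$, the set of polyhedral functions $x\mapsto\max_{k=1,\dots,N}|l_k^\top x|$, with $l_1,\dots,l_N\in\mathbb R^n$, is not universal. -/

import Mathlib

namespace SwitchedSystem

open MeasureTheory Set

-- `‖·‖` on matrices is the operator norm induced by the Euclidean norm.
open scoped Matrix.Norms.L2Operator

/-- The Euclidean space `ℝⁿ`. -/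
abbrev Vec (n : ℕ) : Type := EuclideanSpace ℝ (Fin n)

/-- The space `M_n(ℝ)` of real `n × n` matrices. -/
abbrev Mat (n : ℕ) : Type := Matrix (Fin n) (Fin n) ℝ

/-- `A` is an arbitrary switching law with values in `𝓜`: a measurable function on `[0, ∞)`
taking its values in `𝓜`; measurability is that of all matrix entries. (The values of `A` at negative times play no role anywhere.) -/
def IsSwitchingLaw {n : ℕ} (𝓜 : Set (Mat n)) (A : ℝ → Mat n) : Prop :=
  (∀ i j, Measurable fun t => A t i j) ∧ ∀ t : ℝ, 0 ≤ t → A t ∈ 𝓜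

/-- `Φ` is the fundamental matrix `t ↦ Φ_A(t, 0)` on `[0, ∞)`: the (Carathéodory) solution of
`Φ' = A Φ`, `Φ(0) = Id`, written as an integral equation. For bounded measurable `A` such a `Φ`
exists and is unique on `[0, ∞)`. -/
def IsFundamentalMatrix {n : ℕ} (A Φ : ℝ → Mat n) : Prop :=
  ContinuousOn Φ (Ici 0) ∧ ∀ t : ℝ, 0 ≤ t → Φ t = 1 + ∫ s in (0 : ℝ)..t, A s * Φ s

/-- `x` is a (Carathéodory) solution of `x'(t) = A(t) x(t)`, `t ≥ 0`, written as an integral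
equation. -/
def IsSolution {n : ℕ} (A : ℝ → Mat n) (x : ℝ → Vec n) : Prop :=
  ContinuousOn x (Ici 0) ∧
    ∀ t : ℝ, 0 ≤ t → x t = x 0 + ∫ s in (0 : ℝ)..t, Matrix.toEuclideanLin (A s) (x s)

/-- `x` is a trajectory of the switched system `(Σ_𝓜)`. -/
def IsTrajectory {n : ℕ} (𝓜 : Set (Mat n)) (x : ℝ → Vec n) : Prop :=
  ∃ A : ℝ → Mat n, IsSwitchingLaw 𝓜 A ∧ IsSolution A x

/-- Uniform exponential stability of `(Σ_𝓜)`: there are `C, γ > 0` with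
`‖Φ_A(t, 0)‖ ≤ C e^{-γ t}` for all switching laws `A` and all `t ≥ 0`. -/
def UniformlyExponentiallyStable {n : ℕ} (𝓜 : Set (Mat n)) : Prop :=
  ∃ C γ : ℝ, 0 < C ∧ 0 < γ ∧
    ∀ A : ℝ → Mat n, IsSwitchingLaw 𝓜 A → ∀ Φ : ℝ → Mat n, IsFundamentalMatrix A Φ →
      ∀ t : ℝ, 0 ≤ t → ‖Φ t‖ ≤ C * Real.exp (-γ * t)

/-- Positive definiteness: `V(0) = 0` and `V(x) > 0` for `x ≠ 0`. -/
def PositiveDefinite {n : ℕ} (V : Vec n → ℝ) : Prop :=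
  V 0 = 0 ∧ ∀ x : Vec n, x ≠ 0 → 0 < V x

/-- `V` is a nonstrict common Lyapunov function for `(Σ_𝓜)`. -/
structure IsNonstrictCommonLyapunov {n : ℕ} (𝓜 : Set (Mat n)) (V : Vec n → ℝ) : Prop where
  continuous : Continuous V
  positiveDefinite : PositiveDefinite V
  antitoneOn : ∀ x : ℝ → Vec n, IsTrajectory 𝓜 x → AntitoneOn (fun t => V (x t)) (Ici 0)

/-- `V` is a common Lyapunov function for `(Σ_𝓜)`: moreover `V` is strictly decreasing along
nonzero trajectories (by uniqueness of solutions, those with `x(0) ≠ 0`). -/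
structure IsCommonLyapunov {n : ℕ} (𝓜 : Set (Mat n)) (V : Vec n → ℝ) : Prop
    extends IsNonstrictCommonLyapunov 𝓜 V where
  strictAntiOn : ∀ x : ℝ → Vec n, IsTrajectory 𝓜 x → x 0 ≠ 0 →
    StrictAntiOn (fun t => V (x t)) (Ici 0)

/-- `P` is a universal class of Lyapunov functions on `ℝⁿ`. -/
def IsUniversal {n : ℕ} (P : Set (Vec n → ℝ)) : Prop :=
  ∀ 𝓜 : Set (Mat n), Bornology.IsBounded 𝓜 → UniformlyExponentiallyStable 𝓜 →
    ∃ V ∈ P, IsCommonLyapunov 𝓜 V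

/-- The polynomial functions on `ℝⁿ` of degree at most `d`. -/
def polynomialFunctions (n d : ℕ) : Set (Vec n → ℝ) :=
  {f | ∃ p : MvPolynomial (Fin n) ℝ, p.totalDegree ≤ d ∧
    ∀ x : Vec n, f x = MvPolynomial.eval (fun i => x i) p}

/-- The continuous functions on `ℝⁿ` which at each point agree with one of `l` polynomial
functions of degree at most `d`; the polynomials depend on the function. -/
def piecewisePolynomial (n d l : ℕ) : Set (Vec n → ℝ) :=
  {V | Continuous V ∧ ∃ W : Fin l → Vec n → ℝ, (∀ k, W k ∈ polynomialFunctions n d) ∧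
    ∀ x : Vec n, ∃ k, V x = W k x}

/-- The polyhedral functions `x ↦ max_{k = 1, …, N} |l_kᵀ x|` on `ℝⁿ` (used for `N ≥ 1`). -/
def polyhedral (n N : ℕ) : Set (Vec n → ℝ) :=
  {V | ∃ L : Fin N → Vec n, ∀ x : Vec n, V x = ⨆ k : Fin N, |inner ℝ (L k) x|}

end SwitchedSystem

namespace SwitchedSystem

open MeasureTheory Set Filter Topology
open scoped Matrix.Norms.L2Operator

/-! The idea is to build a stable system whose common Lyapunov functions must all oscillate too
often along one fixed curve. Inscribe a polygonal chain of `m = 2dl + 1` chords in the parabola `(t,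
1 - t²)`, `0 ≤ t ≤ 1`, and let `f k` be the functional equal to `1` on the `k`-th chord. The system
consists of the generators `x ↦ ⟪f k, x⟫ z - (1 + 3ε) x` with `z` bounded and almost in the polar
`|f i| ≤ 1`. It is stable because a seminorm built from the `f i` contracts
(`uniformlyExponentiallyStable_rankOneFamily`).

On the other hand, `z` is nearly free: from any point of a face one reaches any ray through that
face, up to a scalar factor `exp (-3εT)` with `ε (exp T - 1) = 1`, which tends to `1` as `ε → 0`
(`IsCommonLyapunov.lt_of_face`). Hopping from chord to chord, a point of the arc strictly outside a
chord reaches every vertex `q j`, `j < m`. Hence `V` is smaller at all these vertices than at all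
arc midpoints (`IsCommonLyapunov.lt_of_outside`), so `t ↦ V (parabola t)` crosses one level at least
`m` times. A choice among `l` polynomials of degree at most `2d` in `t` allows only `2dl` crossings
(`card_le_of_oscillation`). -/

/-! ### Measurability and integral identities for solutions. -/

lemma norm_toEuclideanLin_apply_le {n : ℕ} (A : Mat n) (x : Vec n) :
    ‖Matrix.toEuclideanLin A x‖ ≤ ‖A‖ * ‖x‖ := by
  simpa [Matrix.toLpLin_apply] using A.l2_opNorm_mulVec x

lemma stronglyMeasurable_of_entries {n : ℕ} {A : ℝ → Mat n}
    (hA : ∀ i j, Measurable fun t => A t i j) : StronglyMeasurable A := by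
  have h : A = fun t => ∑ i, ∑ j, A t i j • Matrix.single i j (1 : ℝ) := by
    funext t
    conv_lhs => rw [Matrix.matrix_eq_sum_single (A t)]
    simp [Matrix.smul_single]
  rw [h]
  refine Finset.stronglyMeasurable_fun_sum _ fun i _ =>
    Finset.stronglyMeasurable_fun_sum _ fun j _ => ?_
  exact (hA i j).stronglyMeasurable.smul_const _

lemma intervalIntegrable_of_bounded {E : Type*} [NormedAddCommGroup E] {g : ℝ → E} {t u C : ℝ}
    (hg : AEStronglyMeasurable g (volume.restrict (Ici 0))) (ht : 0 ≤ t) (htu : t ≤ u)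
    (hC : ∀ s ∈ Icc t u, ‖g s‖ ≤ C) : IntervalIntegrable g volume t u := by
  rw [intervalIntegrable_iff_integrableOn_Icc_of_le htu]
  refine ⟨hg.mono_measure (Measure.restrict_mono (fun s hs => ht.trans hs.1) le_rfl), ?_⟩
  exact HasFiniteIntegral.of_bounded ((ae_restrict_mem measurableSet_Icc).mono hC)

lemma aestronglyMeasurable_apply {n : ℕ} {A : ℝ → Mat n} {x : ℝ → Vec n}
    (hA : ∀ i j, Measurable fun t => A t i j) (hx : ContinuousOn x (Ici 0)) :
    AEStronglyMeasurable (fun s => Matrix.toEuclideanLin (A s) (x s))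
      (volume.restrict (Ici 0)) := by
  have h2 : AEStronglyMeasurable x (volume.restrict (Ici (0 : ℝ))) :=
    hx.aestronglyMeasurable measurableSet_Ici
  have hc : Continuous (Matrix.toEuclideanCLM (n := Fin n) (𝕜 := ℝ)) :=
    AddMonoidHomClass.continuous_of_bound _ 1 fun B => by
      rw [Matrix.l2_opNorm_toEuclideanCLM, one_mul]
  have h1 := (hc.comp_stronglyMeasurable
    (stronglyMeasurable_of_entries hA)).aestronglyMeasurable (μ := volume.restrict (Ici (0 : ℝ)))
  have h3 : Continuous fun p : (Vec n →L[ℝ] Vec n) × Vec n => p.1 p.2 := by fun_prop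
  exact h3.comp_aestronglyMeasurable (h1.prodMk h2)

lemma intervalIntegrable_apply {n : ℕ} {A : ℝ → Mat n} {x : ℝ → Vec n} {K t u : ℝ}
    (hA : ∀ i j, Measurable fun t => A t i j) (hK : ∀ s, 0 ≤ s → ‖A s‖ ≤ K)
    (hx : ContinuousOn x (Ici 0)) (ht : 0 ≤ t) (htu : t ≤ u) :
    IntervalIntegrable (fun s => Matrix.toEuclideanLin (A s) (x s)) volume t u := by
  have hsub : Icc t u ⊆ Ici 0 := fun s hs => ht.trans hs.1
  obtain ⟨C, hC⟩ := isCompact_Icc.exists_bound_of_continuousOn (hx.mono hsub)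
  refine intervalIntegrable_of_bounded (C := K * C) (aestronglyMeasurable_apply hA hx) ht htu ?_
  intro s hs
  refine (norm_toEuclideanLin_apply_le _ _).trans ?_
  exact mul_le_mul (hK s (hsub hs)) (hC s hs) (norm_nonneg _)
    ((norm_nonneg _).trans (hK s (hsub hs)))

lemma intervalIntegrable_mul {n : ℕ} {A Φ : ℝ → Mat n} {K t : ℝ}
    (hA : ∀ i j, Measurable fun t => A t i j) (hK : ∀ s, 0 ≤ s → ‖A s‖ ≤ K)
    (hΦ : ContinuousOn Φ (Ici 0)) (ht : 0 ≤ t) :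
    IntervalIntegrable (fun s => A s * Φ s) volume 0 t := by
  have hsub : Icc 0 t ⊆ Ici 0 := fun s hs => hs.1
  obtain ⟨C, hC⟩ := isCompact_Icc.exists_bound_of_continuousOn (hΦ.mono hsub)
  have h1 : AEStronglyMeasurable A (volume.restrict (Ici (0 : ℝ))) :=
    (stronglyMeasurable_of_entries hA).aestronglyMeasurable
  have h2 : AEStronglyMeasurable Φ (volume.restrict (Ici (0 : ℝ))) :=
    hΦ.aestronglyMeasurable measurableSet_Ici
  refine intervalIntegrable_of_bounded (C := K * C) (h1.mul h2) le_rfl ht ?_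
  intro s hs
  refine (norm_mul_le _ _).trans ?_
  exact mul_le_mul (hK s hs.1) (hC s hs) (norm_nonneg _) ((norm_nonneg _).trans (hK s hs.1))

/-- The columns of the fundamental matrix are solutions. -/
lemma IsFundamentalMatrix.isSolution {n : ℕ} {A Φ : ℝ → Mat n} {K : ℝ}
    (hA : ∀ i j, Measurable fun t => A t i j) (hK : ∀ s, 0 ≤ s → ‖A s‖ ≤ K)
    (hΦ : IsFundamentalMatrix A Φ) (w : Vec n) :
    IsSolution A (fun t => Matrix.toEuclideanLin (Φ t) w) ∧
      Matrix.toEuclideanLin (Φ 0) w = w := by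
  have h0 : Φ 0 = 1 := by simpa using hΦ.2 0 le_rfl
  have hw : Matrix.toEuclideanLin (Φ 0) w = w := by
    rw [h0]; ext i; simp
  let ev : Mat n →L[ℝ] Vec n := LinearMap.toContinuousLinearMap
    ((LinearMap.applyₗ w).comp (Matrix.toEuclideanLin (𝕜 := ℝ) (m := Fin n) (n := Fin n)).toLinearMap)
  have hev : ∀ B, ev B = Matrix.toEuclideanLin B w := fun B => rfl
  refine ⟨⟨ev.continuous.comp_continuousOn hΦ.1, fun t ht => ?_⟩, hw⟩
  have h := congrArg ev (hΦ.2 t ht)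
  rw [map_add, ← ev.intervalIntegral_comp_comm (intervalIntegrable_mul hA hK hΦ.1 ht)] at h
  simp only [hev] at h
  show Matrix.toEuclideanLin (Φ t) w = Matrix.toEuclideanLin (Φ 0) w + _
  rw [hw, h]
  congr 1
  · ext i; simp
  · refine intervalIntegral.integral_congr fun s _ => ?_
    simp [Matrix.toLpLin_apply]

lemma IsSolution.sub_eq_integral {n : ℕ} {A : ℝ → Mat n} {x : ℝ → Vec n} {K t u : ℝ}
    (hA : ∀ i j, Measurable fun t => A t i j) (hK : ∀ s, 0 ≤ s → ‖A s‖ ≤ K)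
    (hx : IsSolution A x) (ht : 0 ≤ t) (htu : t ≤ u) :
    x u - x t = ∫ s in t..u, Matrix.toEuclideanLin (A s) (x s) := by
  rw [hx.2 u (ht.trans htu), hx.2 t ht, add_sub_add_left_eq_sub,
    intervalIntegral.integral_interval_sub_left]
  · exact intervalIntegrable_apply hA hK hx.1 le_rfl (ht.trans htu)
  · exact intervalIntegrable_apply hA hK hx.1 le_rfl ht

/-! ### Exponential decay from contraction of Euler steps. -/

/-- One Euler step with an average of the vector field. -/
lemma IsSolution.mem_of_forall_mem {n : ℕ} {A : ℝ → Mat n} {x : ℝ → Vec n} {K t u : ℝ}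
    (hA : ∀ i j, Measurable fun t => A t i j) (hK : ∀ s, 0 ≤ s → ‖A s‖ ≤ K)
    (hx : IsSolution A x) (ht : 0 ≤ t) (htu : t < u) {S : Set (Vec n)} (hS : Convex ℝ S)
    (hSc : IsClosed S)
    (h : ∀ s ∈ Icc t u, x t + (u - t) • Matrix.toEuclideanLin (A s) (x s) ∈ S) : x u ∈ S := by
  have hi := intervalIntegrable_apply hA hK hx.1 ht htu.le
  have hi' : IntervalIntegrable
      (fun s => x t + (u - t) • Matrix.toEuclideanLin (A s) (x s)) volume t u :=
    intervalIntegrable_const.add (hi.smul (u - t))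
  -- This average equals `x u`, and a closed convex set contains the averages of its points.
  have hmem : (⨍ s in Ioc t u, (x t + (u - t) • Matrix.toEuclideanLin (A s) (x s))) ∈ S := by
    refine hS.set_average_mem hSc ?_ ?_ ?_ hi'.1
    · simpa using htu
    · simp
    · exact (ae_restrict_mem measurableSet_Ioc).mono fun s hs => h s ⟨hs.1.le, hs.2⟩
  have hne : u - t ≠ 0 := (sub_pos.2 htu).ne'
  convert hmem using 1
  rw [← uIoc_of_le htu.le, interval_average_eq, intervalIntegral.integral_add
    intervalIntegrable_const (by exact hi.smul (u - t)), intervalIntegral.integral_smul,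
    ← hx.sub_eq_integral hA hK ht htu.le, intervalIntegral.integral_const, smul_add,
    smul_smul, smul_smul, inv_mul_cancel₀ hne, one_smul, one_smul]
  abel

/-- A seminorm contracted by all Euler steps decays exponentially along solutions. -/
lemma IsSolution.seminorm_le {n : ℕ} {A : ℝ → Mat n} {x : ℝ → Vec n} {K C γ h₀ : ℝ}
    (hA : ∀ i j, Measurable fun t => A t i j) (hK : ∀ s, 0 ≤ s → ‖A s‖ ≤ K)
    (hx : IsSolution A x) (N : Seminorm ℝ (Vec n)) (hN : ∀ v, N v ≤ C * ‖v‖)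
    (hh₀ : 0 < h₀)
    (hstep : ∀ s, 0 ≤ s → ∀ v, ∀ h, 0 < h → h ≤ h₀ →
      N (v + h • Matrix.toEuclideanLin (A s) v) ≤ (1 - γ * h) * N v) {t : ℝ} (ht : 0 ≤ t) :
    N (x t) ≤ Real.exp (-γ * t) * N (x 0) := by
  have hNle : N ≤ C.toNNReal • normSeminorm ℝ (Vec n) := fun v =>
    (hN v).trans (mul_le_mul_of_nonneg_right (Real.le_coe_toNNReal C) (norm_nonneg _))
  have hNc : Continuous N := Seminorm.continuous_of_le
    (by exact (continuous_norm.const_smul C.toNNReal)) hNle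
  have key := le_gronwallBound_of_liminf_deriv_right_le (f := fun s => N (x s))
    (f' := fun s => -γ * N (x s)) (δ := N (x 0)) (K := -γ) (ε := 0) (a := 0) (b := t)
    (hNc.comp_continuousOn (hx.1.mono fun s hs => hs.1)) ?_ le_rfl (fun s _ => by simp) t
    ⟨ht, le_rfl⟩
  · rw [gronwallBound_ε0, sub_zero] at key
    linarith
  · intro s hs r hr
    apply Eventually.frequently
    -- Half of the gap between `r` and `-γ * N (x s)`: the right difference quotients will be at
    -- most `-γ * N (x s) + η < r`.
    set η := (r + γ * N (x s)) / 2 with hη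
    have hηpos : 0 < η := by rw [hη]; linarith
    have hcont : ContinuousWithinAt x (Ici s) s :=
      (hx.1 s hs.1).mono (Ici_subset_Ici.2 hs.1)
    have hlim : Tendsto (fun u => |C| * (K * ‖x u - x s‖)) (𝓝[≥] s) (𝓝 0) := by
      have : Tendsto (fun u => |C| * (K * ‖x u - x s‖)) (𝓝[≥] s)
          (𝓝 (|C| * (K * ‖x s - x s‖))) :=
        ((hcont.sub continuousWithinAt_const).norm.const_mul K).const_mul |C|
      simpa using this
    have hev := hlim.eventually (gt_mem_nhds hηpos)
    obtain ⟨w, hw, hIcc⟩ := (mem_nhdsGE_iff_exists_Icc_subset).1 hev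
    have hs1 : ∀ᶠ z in 𝓝[>] s, z ∈ Ioc s (min w (s + h₀)) :=
      Ioc_mem_nhdsGT (lt_min hw (by linarith))
    filter_upwards [hs1] with z hz
    have hzw := hz.2.trans (min_le_left _ _)
    have hzh := hz.2.trans (min_le_right _ _)
    have hpos : 0 < z - s := sub_pos.2 hz.1
    set R := (1 - γ * (z - s)) * N (x s) + (z - s) * η with hR
    have hmem : x z ∈ {v | N v ≤ R} := by
      refine hx.mem_of_forall_mem hA hK hs.1 hz.1 ?_ (isClosed_le hNc continuous_const) ?_
      · simpa using N.convexOn.convex_le R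
      · intro σ hσ
        have hσ0 : 0 ≤ σ := hs.1.trans hσ.1
        -- Freezing the state at time `s` gives a genuine Euler step; the remainder is small by
        -- continuity of `x`.
        have e : x s + (z - s) • Matrix.toEuclideanLin (A σ) (x σ) =
            (x s + (z - s) • Matrix.toEuclideanLin (A σ) (x s)) +
              (z - s) • Matrix.toEuclideanLin (A σ) (x σ - x s) := by
          rw [map_sub, smul_sub]; abel
        show N _ ≤ R
        rw [e]
        refine (map_add_le_add N _ _).trans (add_le_add
          (hstep σ hσ0 _ _ hpos (by linarith)) ?_)
        rw [map_smul_eq_mul, Real.norm_of_nonneg hpos.le]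
        refine mul_le_mul_of_nonneg_left ?_ hpos.le
        have hlt : |C| * (K * ‖x σ - x s‖) < η := hIcc ⟨hσ.1, hσ.2.trans hzw⟩
        refine le_trans ?_ hlt.le
        refine (hN _).trans ((mul_le_mul_of_nonneg_right (le_abs_self C) (norm_nonneg _)).trans ?_)
        refine mul_le_mul_of_nonneg_left ?_ (abs_nonneg C)
        exact (norm_toEuclideanLin_apply_le _ _).trans
          (mul_le_mul_of_nonneg_right (hK σ hσ0) (norm_nonneg _))
    have hmem' : N (x z) ≤ R := hmem
    rw [inv_mul_lt_iff₀ hpos]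
    have : (z - s) * (-γ * N (x s) + η) < (z - s) * r :=
      mul_lt_mul_of_pos_left (by rw [hη]; linarith) hpos
    nlinarith

lemma uniformlyExponentiallyStable_of_seminorm {n : ℕ} {𝓜 : Set (Mat n)} {K κ C γ h₀ : ℝ}
    (hK : ∀ A ∈ 𝓜, ‖A‖ ≤ K) (N : Seminorm ℝ (Vec n)) (hκ : 0 < κ) (hγ : 0 < γ) (hC : 0 < C)
    (hN : ∀ v, N v ≤ C * ‖v‖) (hN' : ∀ v, κ * ‖v‖ ≤ N v) (hh₀ : 0 < h₀)
    (hstep : ∀ A ∈ 𝓜, ∀ v, ∀ h, 0 < h → h ≤ h₀ →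
      N (v + h • Matrix.toEuclideanLin A v) ≤ (1 - γ * h) * N v) :
    UniformlyExponentiallyStable 𝓜 := by
  refine ⟨C / κ, γ, div_pos hC hκ, hγ, fun A hA Φ hΦ t ht => ?_⟩
  have hK' : ∀ s, 0 ≤ s → ‖A s‖ ≤ K := fun s hs => hK _ (hA.2 s hs)
  rw [Matrix.l2_opNorm_def]
  refine ContinuousLinearMap.opNorm_le_bound _ (by positivity) fun w => ?_
  obtain ⟨hsol, h0⟩ := hΦ.isSolution hA.1 hK' w
  have h1 := hsol.seminorm_le hA.1 hK' N hN hh₀ (fun s hs => hstep _ (hA.2 s hs)) ht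
  rw [h0] at h1
  have h2 := hN' (Matrix.toEuclideanLin (Φ t) w)
  show ‖Matrix.toEuclideanLin (Φ t) w‖ ≤ _
  rw [div_mul_eq_mul_div, div_mul_eq_mul_div, le_div_iff₀ hκ]
  have h3 := mul_le_mul_of_nonneg_left (hN w) (Real.exp_pos (-γ * t)).le
  linarith

/-! ### The rank-one system and its stability. -/

/-- The generators `x ↦ ⟪f k, x⟫ z - (1 + 3 ε) x` with `z` bounded by `R` and almost in the
polar of the functionals `f i`. -/
def rankOneFamily {n m : ℕ} (f : Fin m → Vec n) (ε R : ℝ) : Set (Mat n) :=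
  {A | ∃ k z, (∀ i, |inner ℝ (f i) z| ≤ 1 + 2 * ε) ∧ ‖z‖ ≤ R ∧
    ∀ x, Matrix.toEuclideanLin A x = inner ℝ (f k) x • z - (1 + 3 * ε) • x}

lemma norm_le_of_mem_rankOneFamily {n m : ℕ} {f : Fin m → Vec n} {ε R : ℝ} (hε : 0 < ε)
    (hR : 0 < R) {A : Mat n} (hA : A ∈ rankOneFamily f ε R) :
    ‖A‖ ≤ (∑ i, ‖f i‖) * R + (1 + 3 * ε) := by
  obtain ⟨k, z, -, hz, hA⟩ := hA
  rw [Matrix.l2_opNorm_def]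
  refine ContinuousLinearMap.opNorm_le_bound _ (by positivity) fun x => ?_
  show ‖Matrix.toEuclideanLin A x‖ ≤ _
  rw [hA x]
  refine (norm_sub_le _ _).trans ?_
  rw [norm_smul, norm_smul, add_mul, Real.norm_of_nonneg (show 0 ≤ 1 + 3 * ε by positivity)]
  refine add_le_add_left ?_ _
  have h1 : ‖f k‖ ≤ ∑ i, ‖f i‖ :=
    Finset.single_le_sum (f := fun i => ‖f i‖) (fun i _ => norm_nonneg _) (Finset.mem_univ k)
  calc ‖(inner ℝ (f k) x : ℝ)‖ * ‖z‖ ≤ (‖f k‖ * ‖x‖) * R :=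
        mul_le_mul (norm_inner_le_norm _ _) hz (norm_nonneg _) (by positivity)
    _ ≤ ((∑ i, ‖f i‖) * ‖x‖) * R := by gcongr
    _ = _ := by ring

/-- The seminorm `x ↦ max (maxᵢ |⟪f i, x⟫|) (‖x‖ / R)`. -/
noncomputable def polyhedralSeminorm {n m : ℕ} (f : Fin m → Vec n) (R : ℝ) :
    Seminorm ℝ (Vec n) :=
  (Finset.univ.sup fun i => (normSeminorm ℝ ℝ).comp (innerₛₗ ℝ (f i))) ⊔
    (R⁻¹.toNNReal • normSeminorm ℝ (Vec n))

lemma abs_inner_le_polyhedralSeminorm {n m : ℕ} (f : Fin m → Vec n) (R : ℝ) (i : Fin m)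
    (x : Vec n) : |inner ℝ (f i) x| ≤ polyhedralSeminorm f R x := by
  rw [polyhedralSeminorm, Seminorm.sup_apply]
  refine le_max_of_le_left ?_
  exact Seminorm.le_finset_sup_apply
    (p := fun i => (normSeminorm ℝ ℝ).comp (innerₛₗ ℝ (f i))) (Finset.mem_univ i)

lemma norm_le_polyhedralSeminorm {n m : ℕ} (f : Fin m → Vec n) {R : ℝ} (hR : 0 < R)
    (x : Vec n) : R⁻¹ * ‖x‖ ≤ polyhedralSeminorm f R x := by
  rw [polyhedralSeminorm, Seminorm.sup_apply]
  refine le_max_of_le_right ?_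
  rw [_root_.smul_apply, NNReal.smul_def, Real.coe_toNNReal _ (inv_nonneg.2 hR.le)]
  rfl

lemma polyhedralSeminorm_le {n m : ℕ} {f : Fin m → Vec n} {R a : ℝ} (hR : 0 < R) (ha : 0 ≤ a)
    {x : Vec n} (h : ∀ i, |inner ℝ (f i) x| ≤ a) (h' : R⁻¹ * ‖x‖ ≤ a) :
    polyhedralSeminorm f R x ≤ a := by
  rw [polyhedralSeminorm, Seminorm.sup_apply]
  refine max_le (Seminorm.finset_sup_apply_le ha fun i _ => h i) ?_
  rw [_root_.smul_apply, NNReal.smul_def, Real.coe_toNNReal _ (inv_nonneg.2 hR.le)]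
  exact h'

/-- An Euler step is `(1 - (1 + 3ε)h) v + h ⟪f k, v⟫ z`, where `z` has seminorm at most `1 + 2ε` and
`|⟪f k, v⟫|` is at most the seminorm of `v`. The net rate is `(1 + 3ε) - (1 + 2ε) = ε`. The term
`‖x‖ / R` keeps the seminorm definite when the `f i` do not span. -/
lemma uniformlyExponentiallyStable_rankOneFamily {n m : ℕ} (f : Fin m → Vec n) {ε R : ℝ}
    (hε : 0 < ε) (hR : 0 < R) : UniformlyExponentiallyStable (rankOneFamily f ε R) := by
  refine uniformlyExponentiallyStable_of_seminorm (C := (∑ i, ‖f i‖) + R⁻¹) (γ := ε)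
    (h₀ := (1 + 3 * ε)⁻¹) (fun A => norm_le_of_mem_rankOneFamily hε hR)
    (polyhedralSeminorm f R) (inv_pos.2 hR) hε (by positivity) ?_
    (norm_le_polyhedralSeminorm f hR) (by positivity) ?_
  · intro v
    refine polyhedralSeminorm_le hR (by positivity) (fun i => ?_) ?_
    · refine (abs_real_inner_le_norm _ _).trans (mul_le_mul_of_nonneg_right ?_ (norm_nonneg _))
      have h1 : ‖f i‖ ≤ ∑ i, ‖f i‖ :=
        Finset.single_le_sum (f := fun i => ‖f i‖) (fun i _ => norm_nonneg _) (Finset.mem_univ i)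
      have : 0 ≤ R⁻¹ := by positivity
      linarith
    · refine mul_le_mul_of_nonneg_right ?_ (norm_nonneg _)
      have : 0 ≤ ∑ i, ‖f i‖ := by positivity
      linarith
  · rintro A ⟨k, z, hz, hzR, hA⟩ v h hh hh₀
    have hzN : polyhedralSeminorm f R z ≤ 1 + 2 * ε := by
      refine polyhedralSeminorm_le hR (by positivity) hz ?_
      rw [inv_mul_le_iff₀ hR]
      nlinarith
    have hh1 : 0 ≤ 1 - (1 + 3 * ε) * h := by
      have := mul_le_mul_of_nonneg_left hh₀ (show 0 ≤ 1 + 3 * ε by positivity)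
      rw [mul_inv_cancel₀ (by positivity)] at this
      linarith
    have e : v + h • Matrix.toEuclideanLin A v =
        (1 - (1 + 3 * ε) * h) • v + (h * inner ℝ (f k) v) • z := by
      rw [hA v]; module
    rw [e]
    refine (map_add_le_add _ _ _).trans ?_
    rw [map_smul_eq_mul, map_smul_eq_mul, Real.norm_of_nonneg hh1, norm_mul,
      Real.norm_of_nonneg hh.le, Real.norm_eq_abs]
    have h1 := abs_inner_le_polyhedralSeminorm f R k v
    have h2 : |inner ℝ (f k) v| * polyhedralSeminorm f R z ≤
        polyhedralSeminorm f R v * (1 + 2 * ε) :=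
      mul_le_mul h1 hzN (apply_nonneg _ _) (apply_nonneg _ _)
    nlinarith [mul_le_mul_of_nonneg_left h2 hh.le]

/-! ### Steering along explicit trajectories. -/

lemma exists_toEuclideanLin_eq {n : ℕ} (T : Vec n →ₗ[ℝ] Vec n) :
    ∃ A : Mat n, ∀ x, Matrix.toEuclideanLin A x = T x :=
  ⟨Matrix.toEuclideanLin.symm T, fun x => by rw [LinearEquiv.apply_symm_apply]⟩

lemma isTrajectory_of_hasDerivAt {n : ℕ} {𝓜 : Set (Mat n)} {A : Mat n} (hA : A ∈ 𝓜)
    {x : ℝ → Vec n} (hx : ∀ t, HasDerivAt x (Matrix.toEuclideanLin A (x t)) t) :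
    IsTrajectory 𝓜 x := by
  have hc : Continuous x := continuous_iff_continuousAt.2 fun t => (hx t).continuousAt
  refine ⟨fun _ => A, ⟨fun i j => measurable_const, fun t _ => hA⟩, hc.continuousOn,
    fun t _ => ?_⟩
  have hc' : Continuous fun t => Matrix.toEuclideanLin A (x t) :=
    (Matrix.toEuclideanLin A).continuous_of_finiteDimensional.comp hc
  rw [intervalIntegral.integral_eq_sub_of_hasDerivAt (fun s _ => hx s)
    (hc'.intervalIntegrable _ _)]
  abel

/-- A common Lyapunov function decreases along the flow of `x ↦ ⟪f k, x⟫ z - (1 + 3 ε) x`. -/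
lemma IsCommonLyapunov.lt_of_rankOne {n m : ℕ} {f : Fin m → Vec n} {ε R : ℝ} {V : Vec n → ℝ}
    (hV : IsCommonLyapunov (rankOneFamily f ε R) V) {k : Fin m} {z x : Vec n} {T : ℝ}
    (hz : ∀ i, |inner ℝ (f i) z| ≤ 1 + 2 * ε) (hzR : ‖z‖ ≤ R) (hkz : inner ℝ (f k) z = (1 : ℝ))
    (hx : x ≠ 0) (hT : 0 < T) :
    V (Real.exp (-(1 + 3 * ε) * T) • (x - (inner ℝ (f k) x : ℝ) • z) +
      Real.exp (-(3 * ε) * T) • ((inner ℝ (f k) x : ℝ) • z)) < V x := by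
  set c : ℝ := inner ℝ (f k) x with hc
  obtain ⟨A, hA⟩ := exists_toEuclideanLin_eq
    ((innerₛₗ ℝ (f k)).smulRight z - (1 + 3 * ε) • (LinearMap.id : Vec n →ₗ[ℝ] Vec n))
  replace hA : ∀ x, Matrix.toEuclideanLin A x = inner ℝ (f k) x • z - (1 + 3 * ε) • x :=
    fun x => by rw [hA]; rfl
  -- Since `⟪f k, z⟫ = 1`, the generator has eigenvalue `-3ε` on `z` and `-(1 + 3ε)` on the kernel
  -- of `f k`, which contains `x - c • z`.
  let y : ℝ → Vec n := fun t => Real.exp (-(1 + 3 * ε) * t) • (x - c • z) +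
    Real.exp (-(3 * ε) * t) • (c • z)
  have hy : ∀ t, HasDerivAt y (Matrix.toEuclideanLin A (y t)) t := by
    intro t
    have h1 : ∀ a : ℝ, HasDerivAt (fun t => Real.exp (a * t)) (Real.exp (a * t) * a) t :=
      fun a => by simpa using ((hasDerivAt_id t).const_mul a).exp
    refine (((h1 (-(1 + 3 * ε))).smul_const (x - c • z)).add
      ((h1 (-(3 * ε))).smul_const (c • z))).congr_deriv ?_
    rw [hA]
    simp only [y, inner_add_right, inner_smul_right, inner_sub_right, hkz, ← hc]
    module
  have h0 : y 0 = x := by simp [y]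
  have := hV.strictAntiOn y (isTrajectory_of_hasDerivAt (𝓜 := rankOneFamily f ε R) (A := A) ⟨k, z, hz, hzR, hA⟩ hy)
    (by rwa [h0]) (mem_Ici.2 le_rfl) (mem_Ici.2 hT.le) hT
  simpa only [h0] using this

/-- Steering a point `x`, at which the maximum of the functionals is attained by `f k`, onto the
ray through a point `q` of the face `f k = 1`. -/
lemma IsCommonLyapunov.lt_of_face {n m : ℕ} {f : Fin m → Vec n} {ε R : ℝ} {V : Vec n → ℝ}
    (hV : IsCommonLyapunov (rankOneFamily f ε R) V) {k : Fin m} {q x : Vec n} {T μ : ℝ}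
    (hT : 0 < T) (hε : 0 < ε) (hεT : ε * (Real.exp T - 1) = 1)
    (hq : ∀ i, |inner ℝ (f i) q| ≤ 1) (hkq : inner ℝ (f k) q = (1 : ℝ)) (hμ : 0 < μ)
    (hx : ∀ i, |inner ℝ (f i) x| ≤ μ) (hkx : inner ℝ (f k) x = μ)
    (hR : ‖q‖ + ε * (‖q‖ + μ⁻¹ * ‖x‖) ≤ R) :
    V ((Real.exp (-(3 * ε) * T) * μ) • q) < V x := by
  have hx0 : x ≠ 0 := by rintro rfl; simp at hkx; exact hμ.ne hkx
  -- The target overshoots `q`, away from `μ⁻¹ • x`, by a proportion `ε`; this keeps `⟪f k, z⟫ = 1`.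
  -- The relation `ε (exp T - 1) = 1` is what cancels the component along `x` at time `T`.
  have key := hV.lt_of_rankOne (k := k) (z := q + ε • (q - μ⁻¹ • x)) (x := x) (T := T)
    (fun i => ?_) ?_ ?_ hx0 hT
  · rw [hkx] at key
    convert key using 2
    have e1 : Real.exp (-(1 + 3 * ε) * T) = Real.exp (-(3 * ε) * T) * Real.exp (-T) := by
      rw [← Real.exp_add]; ring_nf
    have e2 : ε * (1 - Real.exp (-T)) = Real.exp (-T) := by
      have h : Real.exp T * Real.exp (-T) = 1 := by rw [← Real.exp_add]; simp
      linear_combination Real.exp (-T) * hεT - ε * h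
    have e3 : μ * μ⁻¹ = 1 := mul_inv_cancel₀ hμ.ne'
    rw [e1]
    generalize Real.exp (-(3 * ε) * T) = a at *
    generalize Real.exp (-T) = b at *
    match_scalars
    · linear_combination (-(a * μ)) * e2
    · linear_combination a * e2 + a * ε * (1 - b) * e3
  · rw [inner_add_right, inner_smul_right, inner_sub_right, inner_smul_right]
    have h1 := hq i
    have h2 : |μ⁻¹ * inner ℝ (f i) x| ≤ 1 := by
      rw [abs_mul, abs_of_pos (inv_pos.2 hμ), inv_mul_le_iff₀ hμ, mul_one]
      exact hx i
    rw [abs_le] at *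
    constructor <;> nlinarith
  · refine (norm_add_le _ _).trans (le_trans ?_ hR)
    rw [norm_smul, Real.norm_of_nonneg hε.le]
    refine add_le_add_right (mul_le_mul_of_nonneg_left ((norm_sub_le _ _).trans ?_) hε.le) _
    rw [norm_smul, Real.norm_of_nonneg (inv_pos.2 hμ).le]
  · rw [inner_add_right, inner_smul_right, inner_sub_right, inner_smul_right, hkq, hkx,
      inv_mul_cancel₀ hμ.ne']
    ring

/-- Radial decrease on the rays through the points of a face. -/
lemma IsCommonLyapunov.le_of_ray {n m : ℕ} {f : Fin m → Vec n} {ε R : ℝ} {V : Vec n → ℝ}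
    (hV : IsCommonLyapunov (rankOneFamily f ε R) V) {k : Fin m} {q : Vec n} {s s' : ℝ}
    (hε : 0 < ε) (hq : ∀ i, |inner ℝ (f i) q| ≤ 1) (hkq : inner ℝ (f k) q = (1 : ℝ))
    (hR : ‖q‖ ≤ R) (hs : 0 < s) (hss : s ≤ s') : V (s • q) ≤ V (s' • q) := by
  rcases hss.eq_or_lt with rfl | hlt
  · rfl
  have hs' := hs.trans hlt
  have hq0 : q ≠ 0 := by rintro rfl; simp at hkq
  -- With `z = q` the ray is invariant and decays at rate `3ε`, so this `T` is the time from `s'` to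
  -- `s`.
  have h := hV.lt_of_rankOne (k := k) (z := q) (x := s' • q) (T := Real.log (s' / s) / (3 * ε))
    (fun i => (hq i).trans (by linarith)) hR hkq (smul_ne_zero hs'.ne' hq0)
    (div_pos (Real.log_pos ((one_lt_div hs).2 hlt)) (by positivity))
  rw [inner_smul_right, hkq, mul_one, sub_self, smul_zero, zero_add, smul_smul] at h
  have e : Real.exp (-(3 * ε) * (Real.log (s' / s) / (3 * ε))) * s' = s := by
    rw [neg_mul, mul_div_cancel₀ _ (by positivity), Real.exp_neg,
      Real.exp_log (div_pos hs' hs), inv_div, div_mul_cancel₀ _ hs'.ne']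
  rw [e] at h
  exact h.le

/-! ### Counting oscillations of piecewise polynomials. -/

/-- A function that agrees pointwise with one of `l` polynomials of degree at most `D` cannot
oscillate more than `l * D` times between separated values. -/
lemma card_le_of_oscillation {M l D : ℕ} {φ : ℝ → ℝ} (hφ : Continuous φ)
    (p : Fin l → Polynomial ℝ) (hp : ∀ k, (p k).natDegree ≤ D)
    (hφp : ∀ t, ∃ k, φ t = (p k).eval t) (a b : Fin M → ℝ) (hab : ∀ i, a i ≤ b i)
    (hba : ∀ i j, i < j → b i ≤ a j) (h : ∀ i j, φ (a i) < φ (b j)) : M ≤ l * D := by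
  rcases Nat.eq_zero_or_pos M with rfl | hM
  · exact Nat.zero_le _
  have : Nonempty (Fin M) := ⟨⟨0, hM⟩⟩
  obtain ⟨i₀, hi₀⟩ := Finite.exists_max fun i => φ (a i)
  obtain ⟨j₀, hj₀⟩ := Finite.exists_min fun j => φ (b j)
  -- A common level for all crossings; avoiding the finitely many constant coefficients ensures that
  -- no `p k` is the constant `c`.
  obtain ⟨c, hc, hcp⟩ : (Ioo (φ (a i₀)) (φ (b j₀)) \ range fun k => (p k).coeff 0).Nonempty :=
    ((Ioo_infinite (h i₀ j₀)).sdiff (finite_range _)).nonempty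
  have hne : ∀ k, p k - Polynomial.C c ≠ 0 := by
    intro k hk
    refine hcp ⟨k, ?_⟩
    simp [sub_eq_zero.1 hk]
  have hr : ∀ i, ∃ t ∈ Ioo (a i) (b i), φ t = c := fun i =>
    intermediate_value_Ioo (hab i) hφ.continuousOn
      ⟨(hi₀ i).trans_lt hc.1, hc.2.trans_le (hj₀ i)⟩
  choose r hr hrc using hr
  have hmono : StrictMono r := fun i j hij =>
    (hr i).2.trans_le ((hba i j hij).trans (hr j).1.le)
  have hsub : Finset.univ.image r ⊆
      Finset.univ.biUnion fun k => (p k - Polynomial.C c).roots.toFinset := by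
    intro t ht
    obtain ⟨i, -, rfl⟩ := Finset.mem_image.1 ht
    obtain ⟨k, hk⟩ := hφp (r i)
    refine Finset.mem_biUnion.2 ⟨k, Finset.mem_univ _, ?_⟩
    rw [Multiset.mem_toFinset, Polynomial.mem_roots (hne k)]
    simp [Polynomial.IsRoot, ← hk, hrc]
  calc M = (Finset.univ.image r).card := by
        rw [Finset.card_image_of_injective _ hmono.injective, Finset.card_univ, Fintype.card_fin]
    _ ≤ _ := Finset.card_le_card hsub
    _ ≤ ∑ k : Fin l, (p k - Polynomial.C c).roots.toFinset.card := Finset.card_biUnion_le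
    _ ≤ ∑ _k : Fin l, D := by
        refine Finset.sum_le_sum fun k _ => ?_
        refine (Multiset.toFinset_card_le _).trans ((Polynomial.card_roots' _).trans ?_)
        rw [Polynomial.natDegree_sub_C]
        exact hp k
    _ = l * D := by simp

/-! ### Chords of the parabola and the choice of `ε`. -/

/-- The point `(t, 1 - t ^ 2)` in the frame `(u, v)`. -/
def parabola {n : ℕ} (u v : Vec n) (t : ℝ) : Vec n := t • u + (1 - t ^ 2) • v

/-- The functional equal to `1` on the chord of the parabola between the parameters `a`, `b`. -/
noncomputable def chord {n : ℕ} (u v : Vec n) (a b : ℝ) : Vec n :=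
  (1 + a * b)⁻¹ • ((a + b) • u + v)

lemma exists_polynomial_comp_parabola {n d : ℕ} (u v : Vec n) {W : Vec n → ℝ}
    (hW : W ∈ polynomialFunctions n d) :
    ∃ p : Polynomial ℝ, p.natDegree ≤ d * 2 ∧ ∀ t, W (parabola u v t) = p.eval t := by
  obtain ⟨P, hP, hWP⟩ := hW
  let g : Fin n → Polynomial ℝ := fun i =>
    Polynomial.X * Polynomial.C (u i) + (1 - Polynomial.X ^ 2) * Polynomial.C (v i)
  refine ⟨MvPolynomial.aeval g P, MvPolynomial.aeval_natDegree_le P hP g fun i => ?_,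
    fun t => ?_⟩
  · simp only [g]
    compute_degree
  · rw [hWP, ← Polynomial.coe_evalRingHom, MvPolynomial.aeval_def, MvPolynomial.hom_eval₂]
    rw [MvPolynomial.eval, MvPolynomial.coe_eval₂Hom]
    congr 1
    · ext x; simp
    · funext i; simp [g, parabola]; ring

/-- The sign of `(t - a) * (t - b)` shows that only the arc strictly between the endpoints lies
beyond the chord. -/
lemma inner_chord_parabola {n : ℕ} {u v : Vec n} (hu : ‖u‖ = 1) (hv : ‖v‖ = 1)
    (huv : inner ℝ u v = (0 : ℝ)) {a b : ℝ} (hab : 0 < 1 + a * b) (t : ℝ) :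
    inner ℝ (chord u v a b) (parabola u v t) = 1 - (t - a) * (t - b) / (1 + a * b) := by
  have hvu : inner ℝ v u = (0 : ℝ) := by rw [real_inner_comm]; exact huv
  simp only [chord, parabola, inner_add_left, inner_add_right, inner_smul_left, inner_smul_right,
    huv, hvu, real_inner_self_eq_norm_sq, hu, hv]
  simp
  field_simp
  ring

lemma norm_parabola_le {n : ℕ} {u v : Vec n} (hu : ‖u‖ = 1) (hv : ‖v‖ = 1) {t : ℝ}
    (ht : 0 ≤ t) (ht' : t ≤ 1) : ‖parabola u v t‖ ≤ 2 := by
  refine (norm_add_le _ _).trans ?_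
  rw [norm_smul, norm_smul, hu, hv, Real.norm_of_nonneg ht, Real.norm_of_nonneg (by nlinarith)]
  nlinarith

/-- Makes the total loss of `m + 1` steerings smaller than the margin `c`. As `exp T - 1 ≥ T² / 2`,
one has `εT ≤ 2 / T`, so the logarithmic loss `3(m + 1)εT` is at most `6(m + 1) / T ≤ log c`. -/
lemma exists_rate (m : ℕ) {c : ℝ} (hc : 1 < c) : ∃ ε T : ℝ, 0 < ε ∧ ε ≤ 1 ∧ 0 < T ∧
    ε * (Real.exp T - 1) = 1 ∧ 1 ≤ Real.exp (-(3 * ε) * T) ^ (m + 1) * c := by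
  have hL : 0 < Real.log c := Real.log_pos hc
  set T : ℝ := 6 * (m + 1) / Real.log c + 1 with hT
  have hT1 : 1 ≤ T := by rw [hT]; have : 0 ≤ 6 * (m + 1) / Real.log c := by positivity
                         linarith
  have hE : 1 + T + T ^ 2 / 2 ≤ Real.exp T := Real.quadratic_le_exp_of_nonneg (by linarith)
  have hE1 : 1 ≤ Real.exp T - 1 := by nlinarith
  have hE0 : 0 < Real.exp T - 1 := by linarith
  refine ⟨(Real.exp T - 1)⁻¹, T, inv_pos.2 hE0, inv_le_one_of_one_le₀ hE1, by linarith,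
    inv_mul_cancel₀ hE0.ne', ?_⟩
  have hc' : c = Real.exp (Real.log c) := (Real.exp_log (zero_lt_one.trans hc)).symm
  conv_rhs => rw [hc']
  rw [← Real.exp_nat_mul, ← Real.exp_add, Real.one_le_exp_iff]
  have h1 : (Real.exp T - 1)⁻¹ * T ≤ 2 / T := by
    rw [inv_mul_le_iff₀ hE0, mul_div_assoc', le_div_iff₀ (by linarith)]
    nlinarith
  have h2 : 6 * (m + 1) ≤ Real.log c * T := by
    rw [hT, mul_add (Real.log c), mul_div_cancel₀ _ hL.ne']; linarith
  have h3 : (m + 1) * (2 / T) * 3 ≤ Real.log c := by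
    rw [mul_div_assoc', div_mul_eq_mul_div, div_le_iff₀ (by linarith)]
    linarith
  have h4 := mul_le_mul_of_nonneg_left h1 (show (0 : ℝ) ≤ (m + 1) * 3 by positivity)
  push_cast
  nlinarith

/-! ### Travelling along a chain of faces. -/

section Chain

variable {n m : ℕ} {f : Fin m → Vec n} {ε T : ℝ} {V : Vec n → ℝ} {q : ℕ → Vec n}

-- The radius `6` leaves room for the targets: `‖q'‖ + ε (‖q'‖ + ‖q‖) ≤ 2 + (2 + 2)`.
lemma IsCommonLyapunov.le_of_edge (hV : IsCommonLyapunov (rankOneFamily f ε 6) V)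
    (hε : 0 < ε) (hε1 : ε ≤ 1) (hT : 0 < T) (hεT : ε * (Real.exp T - 1) = 1)
    {k : Fin m} {q q' : Vec n} (hq : ∀ i, |inner ℝ (f i) q| ≤ 1) (hn : ‖q‖ ≤ 2)
    (hkq : inner ℝ (f k) q = (1 : ℝ)) (hq' : ∀ i, |inner ℝ (f i) q'| ≤ 1) (hn' : ‖q'‖ ≤ 2)
    (hkq' : inner ℝ (f k) q' = (1 : ℝ)) {s : ℝ} (hs : 0 < s) :
    V ((Real.exp (-(3 * ε) * T) * s) • q') ≤ V (s • q) := by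
  refine (hV.lt_of_face hT hε hεT hq' hkq' hs (fun i => ?_) ?_ ?_).le
  · rw [inner_smul_right, abs_mul, abs_of_pos hs]
    exact mul_le_of_le_one_right hs.le (hq i)
  · rw [inner_smul_right, hkq, mul_one]
  · rw [norm_smul, Real.norm_of_nonneg hs.le, inv_mul_cancel_left₀ hs.ne']
    nlinarith

/-- Consecutive vertices share a face, which can be traversed in either direction at the cost of one
factor `exp (-3εT)`. -/
lemma IsCommonLyapunov.le_of_chain (hV : IsCommonLyapunov (rankOneFamily f ε 6) V)
    (hε : 0 < ε) (hε1 : ε ≤ 1) (hT : 0 < T) (hεT : ε * (Real.exp T - 1) = 1)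
    (hq : ∀ j ≤ m, ∀ i, |inner ℝ (f i) (q j)| ≤ 1) (hn : ∀ j ≤ m, ‖q j‖ ≤ 2)
    (hl : ∀ k : Fin m, inner ℝ (f k) (q k) = (1 : ℝ))
    (hr : ∀ k : Fin m, inner ℝ (f k) (q (k + 1)) = (1 : ℝ)) (p i : ℕ) (hip : i + p ≤ m)
    {s : ℝ} (hs : 0 < s) :
    V ((Real.exp (-(3 * ε) * T) ^ p * s) • q (i + p)) ≤ V (s • q i) ∧
    V ((Real.exp (-(3 * ε) * T) ^ p * s) • q i) ≤ V (s • q (i + p)) := by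
  induction p generalizing s with
  | zero => simp
  | succ p ih =>
    have hs' : 0 < Real.exp (-(3 * ε) * T) ^ p * s := by positivity
    have hs'' : 0 < Real.exp (-(3 * ε) * T) * s := by positivity
    have h1 : i + p ≤ m := by omega
    have h2 : i + p + 1 ≤ m := by omega
    have h3 : i + p < m := by omega
    constructor
    · refine le_trans ?_ (ih h1 hs).1
      rw [pow_succ', mul_assoc]
      exact hV.le_of_edge hε hε1 hT hεT (k := ⟨i + p, h3⟩) (hq _ h1) (hn _ h1) (hl _)
        (hq _ h2) (hn _ h2) (hr ⟨i + p, h3⟩) hs'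
    · refine le_trans ?_ (hV.le_of_edge hε hε1 hT hεT (k := ⟨i + p, h3⟩) (hq _ h2) (hn _ h2)
        (hr ⟨i + p, h3⟩) (hq _ h1) (hn _ h1) (hl _) hs)
      rw [pow_succ, mul_assoc]
      exact (ih h1 hs'').2

/-- A point slightly outside an edge of a chain can be steered to every vertex of the chain. -/
lemma IsCommonLyapunov.lt_of_outside (hV : IsCommonLyapunov (rankOneFamily f ε 6) V)
    (hε : 0 < ε) (hε1 : ε ≤ 1) (hT : 0 < T) (hεT : ε * (Real.exp T - 1) = 1)
    (hq : ∀ j ≤ m, ∀ i, |inner ℝ (f i) (q j)| ≤ 1) (hn : ∀ j ≤ m, ‖q j‖ ≤ 2)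
    (hl : ∀ k : Fin m, inner ℝ (f k) (q k) = (1 : ℝ))
    (hr : ∀ k : Fin m, inner ℝ (f k) (q (k + 1)) = (1 : ℝ)) {k : Fin m} {x : Vec n} {μ c : ℝ}
    (hx : ∀ i, |inner ℝ (f i) x| ≤ μ) (hkx : inner ℝ (f k) x = μ) (hxn : ‖x‖ ≤ 2)
    (hc : 1 < c) (hcμ : c ≤ μ)
    (hρ : 1 ≤ Real.exp (-(3 * ε) * T) ^ (m + 1) * c) {j : ℕ} (hj : j < m) :
    V (q j) < V x := by
  have hμ : 1 < μ := hc.trans_le hcμ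
  set ρ := Real.exp (-(3 * ε) * T) with hρdef
  have hρ0 : 0 < ρ := Real.exp_pos _
  have hρ1 : ρ ≤ 1 := Real.exp_le_one_iff.2 (by
    have : 0 < 3 * ε * T := by positivity
    linarith)
  have h1 : V ((ρ * μ) • q k) < V x := by
    refine hV.lt_of_face hT hε hεT (hq _ k.2.le) (hl k) (by linarith) hx hkx ?_
    have h3 : μ⁻¹ * ‖x‖ ≤ 2 := by
      rw [inv_mul_le_iff₀ (by linarith)]
      nlinarith
    have := hn k k.2.le
    have h4 := norm_nonneg x
    nlinarith
  have h2 : ∃ p ≤ m, V ((ρ ^ p * (ρ * μ)) • q j) ≤ V ((ρ * μ) • q k) := by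
    have hs : 0 < ρ * μ := by positivity
    rcases le_total (k : ℕ) j with hkj | hkj
    · obtain ⟨p, rfl⟩ := Nat.exists_eq_add_of_le hkj
      exact ⟨p, by omega, (hV.le_of_chain hε hε1 hT hεT hq hn hl hr p k (by omega) hs).1⟩
    · obtain ⟨p, hp⟩ := Nat.exists_eq_add_of_le hkj
      have hkm := k.2
      refine ⟨p, by omega, ?_⟩
      rw [hp]
      exact (hV.le_of_chain hε hε1 hT hεT hq hn hl hr p j (by omega) hs).2
  obtain ⟨p, hp, h2⟩ := h2
  -- One factor `ρ` for reaching the chain and `p ≤ m` for moving along it: the arrival point is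
  -- still at or beyond `q j`, and radial monotonicity concludes.
  have h3 : 1 ≤ ρ ^ p * (ρ * μ) := by
    rw [← mul_assoc, ← pow_succ]
    refine hρ.trans (mul_le_mul ?_ hcμ (by linarith) (by positivity))
    exact pow_le_pow_of_le_one hρ0.le hρ1 (by omega)
  have h4 := hV.le_of_ray hε (hq j hj.le) (hl ⟨j, hj⟩) ((hn j hj.le).trans (by norm_num))
    one_pos h3
  rw [one_smul] at h4
  exact (h4.trans h2).trans_lt h1

end Chain

/-! ### The counterexample and the polyhedral case. -/

theorem not_isUniversal_piecewisePolynomial {n : ℕ} (hn : 2 ≤ n) (d l : ℕ) :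
    ¬ IsUniversal (piecewisePolynomial n d l) := by
  intro hU
  -- One more than the bound of `card_le_of_oscillation`, the degree being doubled by restriction to
  -- the parabola.
  obtain ⟨m, hm⟩ : ∃ m, m = l * (d * 2) + 1 := ⟨_, rfl⟩
  have hm0 : (0 : ℝ) < m := by rw [hm]; positivity
  let u : Vec n := EuclideanSpace.single ⟨0, by omega⟩ 1
  let v : Vec n := EuclideanSpace.single ⟨1, by omega⟩ 1
  have hu : ‖u‖ = 1 := by simp [u]
  have hv : ‖v‖ = 1 := by simp [v]
  have huv : inner ℝ u v = (0 : ℝ) := by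
    simp [u, v, EuclideanSpace.inner_single_left]
  let f : Fin m → Vec n := fun k => chord u v (k / m) ((k + 1) / m)
  have hden : ∀ k : Fin m, 0 < 1 + (k : ℝ) / m * (((k : ℝ) + 1) / m) := fun k => by positivity
  have hf : ∀ k t, inner ℝ (f k) (parabola u v t) =
      1 - (t - k / m) * (t - (k + 1) / m) / (1 + (k : ℝ) / m * (((k : ℝ) + 1) / m)) :=
    fun k t => inner_chord_parabola hu hv huv (hden k) t
  have h01 : ∀ k : Fin m, 0 ≤ (k : ℝ) / m ∧ ((k : ℝ) + 1) / m ≤ 1 := fun k =>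
    ⟨by positivity, by rw [div_le_one hm0]; exact_mod_cast k.2⟩
  have hlt : ∀ k : Fin m, (k : ℝ) / m ≤ ((k : ℝ) + 1) / m := fun k => by gcongr; linarith
  have hbound : ∀ (k : Fin m) (t : ℝ), 0 ≤ t → t ≤ 1 →
      (t ≤ (k : ℝ) / m ∨ ((k : ℝ) + 1) / m ≤ t) → |inner ℝ (f k) (parabola u v t)| ≤ 1 := by
    intro k t ht ht' hor
    have h1 := (h01 k).1
    have h2 := (h01 k).2
    have h3 := hlt k
    rw [hf, abs_le]
    have hnn : 0 ≤ (t - k / m) * (t - (k + 1) / m) := by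
      rcases hor with h | h
      · exact mul_nonneg_of_nonpos_of_nonpos (by linarith) (by linarith)
      · exact mul_nonneg (by linarith) (by linarith)
    have h4 : (t - k / m) * (t - (k + 1) / m) / (1 + (k : ℝ) / m * (((k : ℝ) + 1) / m)) ≤ 1 := by
      rw [div_le_one (hden k)]
      nlinarith
    have h5 := div_nonneg hnn (hden k).le
    constructor <;> linarith
  set q : ℕ → Vec n := fun j => parabola u v (j / m) with hq
  have hj01 : ∀ j ≤ m, 0 ≤ (j : ℝ) / m ∧ (j : ℝ) / m ≤ 1 := fun j hj =>
    ⟨by positivity, by rw [div_le_one hm0]; exact_mod_cast hj⟩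
  have hqb : ∀ j ≤ m, ∀ i, |inner ℝ (f i) (q j)| ≤ 1 := by
    intro j hj i
    refine hbound i _ (hj01 j hj).1 (hj01 j hj).2 ?_
    rcases Nat.lt_or_ge i j with h | h
    · right; gcongr; exact_mod_cast h
    · left; gcongr
  have hqn : ∀ j ≤ m, ‖q j‖ ≤ 2 := fun j hj =>
    norm_parabola_le hu hv (hj01 j hj).1 (hj01 j hj).2
  have hl : ∀ k : Fin m, inner ℝ (f k) (q k) = (1 : ℝ) := fun k => by simp [hq, hf]
  have hr : ∀ k : Fin m, inner ℝ (f k) (q (k + 1)) = (1 : ℝ) := fun k => by simp [hq, hf]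
  set b : Fin m → ℝ := fun k => ((k : ℝ) + 1 / 2) / m with hb
  have hkb : ∀ k : Fin m, (k : ℝ) / m ≤ b k := fun k => by simp only [hb]; gcongr; linarith
  have hbk : ∀ k : Fin m, b k ≤ ((k : ℝ) + 1) / m := fun k => by simp only [hb]; gcongr; linarith
  have hb0 : ∀ k, 0 ≤ b k := fun k => (h01 k).1.trans (hkb k)
  have hb1 : ∀ k, b k ≤ 1 := fun k => (hbk k).trans (h01 k).2
  -- At the parameter midpoint the excess over `1` is `1 / (4m²)` divided by `1 + ab ≤ 2`, where
  -- `a`, `b` are the endpoints of the chord.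
  set c : ℝ := 1 + 1 / (8 * (m : ℝ) ^ 2) with hc
  have hc1 : 1 < c := by rw [hc]; have : 0 < 1 / (8 * (m : ℝ) ^ 2) := by positivity
                         linarith
  have hμ : ∀ k, c ≤ inner ℝ (f k) (parabola u v (b k)) := by
    intro k
    have e : (b k - k / m) * (b k - (k + 1) / m) = -(1 / (4 * (m : ℝ) ^ 2)) := by
      simp only [hb]; field_simp; ring
    rw [hf, e, neg_div, sub_neg_eq_add, hc, div_div]
    have h3 : (k : ℝ) / m * (((k : ℝ) + 1) / m) ≤ 1 :=
      mul_le_one₀ ((hlt k).trans (h01 k).2) ((h01 k).1.trans (hlt k)) (h01 k).2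
    have h4 := hden k
    refine add_le_add_right (one_div_le_one_div_of_le (by positivity) ?_) _
    nlinarith [mul_le_mul_of_nonneg_left h3 (sq_nonneg (m : ℝ))]
  obtain ⟨ε, T, hε, hε1, hT, hεT, hρ⟩ := exists_rate m hc1
  obtain ⟨V, ⟨hVc, W, hW, hVW⟩, hV⟩ := hU (rankOneFamily f ε 6)
    (isBounded_iff_forall_norm_le.2
      ⟨_, fun A hA => norm_le_of_mem_rankOneFamily hε (by norm_num) hA⟩)
    (uniformlyExponentiallyStable_rankOneFamily f hε (by norm_num))
  have hsep : ∀ j k : Fin m, V (parabola u v ((j : ℝ) / m)) < V (parabola u v (b k)) := by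
    intro j k
    refine hV.lt_of_outside hε hε1 hT hεT hqb hqn hl hr (k := k) (c := c) (fun i => ?_) rfl
      (norm_parabola_le hu hv (hb0 k) (hb1 k)) hc1 (hμ k) hρ j.2
    -- The arc midpoint `b k` lies beyond the `k`-th chord only, so `f k` attains the maximum there.
    rcases lt_trichotomy i k with h | rfl | h
    · refine (hbound i _ (hb0 k) (hb1 k) (Or.inr (le_trans ?_ (hkb k)))).trans
        (hc1.le.trans (hμ k))
      gcongr; exact_mod_cast h
    · rw [abs_of_pos (by linarith [hμ i])]
    · refine (hbound i _ (hb0 k) (hb1 k) (Or.inl ((hbk k).trans ?_))).trans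
        (hc1.le.trans (hμ k))
      gcongr; exact_mod_cast h
  choose p hpd hp using fun k => exists_polynomial_comp_parabola u v (hW k)
  have hcont : Continuous fun t => V (parabola u v t) :=
    hVc.comp (by unfold parabola; fun_prop)
  have := card_le_of_oscillation hcont p hpd
    (fun t => (hVW (parabola u v t)).imp fun k hk => hk.trans (hp k t))
    (fun k : Fin m => (k : ℝ) / m) b hkb
    (fun i j hij => (hbk i).trans (by gcongr; exact_mod_cast hij)) hsep
  omega

/-- The maximum is attained, so its value is one of the `2N` linear forms `±⟪L k, x⟫`. -/
theorem polyhedral_subset_piecewisePolynomial (n : ℕ) {N : ℕ} (hN : 0 < N) :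
    polyhedral n N ⊆ piecewisePolynomial n 1 (N + N) := by
  rintro V ⟨L, hL⟩
  have : Nonempty (Fin N) := ⟨⟨0, hN⟩⟩
  have hpoly : ∀ w : Vec n, (fun x => inner ℝ w x) ∈ polynomialFunctions n 1 := by
    intro w
    refine ⟨∑ i, MvPolynomial.C (w i) * MvPolynomial.X i, ?_, fun x => ?_⟩
    · refine (MvPolynomial.totalDegree_finsetSum _ _).trans (Finset.sup_le fun i _ => ?_)
      refine (MvPolynomial.totalDegree_mul _ _).trans ?_
      simp
    · simp [PiLp.inner_apply, mul_comm]
  refine ⟨?_, Fin.append (fun k x => inner ℝ (L k) x) (fun k x => inner ℝ (-L k) x), ?_, ?_⟩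
  · have : V = Finset.univ.sup' Finset.univ_nonempty fun k x => |inner ℝ (L k) x| := by
      funext x
      rw [hL, Finset.sup'_apply, Finset.sup'_univ_eq_ciSup]
    rw [this]
    exact Continuous.finset_sup' _ fun k _ => by fun_prop
  · intro k
    refine Fin.addCases (fun k => ?_) (fun k => ?_) k
    · simpa using hpoly (L k)
    · rw [Fin.append_right]; exact hpoly (-L k)
  · intro x
    obtain ⟨k, hk⟩ := exists_eq_ciSup_of_finite (f := fun k => |inner ℝ (L k) x|)
    rw [hL, ← hk]
    rcases abs_choice (inner ℝ (L k) x : ℝ) with h | h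
    · exact ⟨Fin.castAdd N k, by simpa using h⟩
    · exact ⟨Fin.natAdd N k, by rw [Fin.append_right, inner_neg_left]; exact h⟩

end SwitchedSystem

theorem mainTheorem5 (n : ℕ) (hn : 2 ≤ n) :
    (∀ d l : ℕ, 0 < l →
      ¬ SwitchedSystem.IsUniversal (SwitchedSystem.piecewisePolynomial n d l)) ∧
    (∀ N : ℕ, 0 < N →
      ¬ SwitchedSystem.IsUniversal (SwitchedSystem.polyhedral n N)) := by
  refine ⟨fun d l _ => SwitchedSystem.not_isUniversal_piecewisePolynomial hn d l,
    fun N hN hU => ?_⟩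
  refine SwitchedSystem.not_isUniversal_piecewisePolynomial hn 1 (N + N) fun 𝓜 hM hS => ?_
  obtain ⟨V, hV, hL⟩ := hU 𝓜 hM hS
  exact ⟨V, SwitchedSystem.polyhedral_subset_piecewisePolynomial n hN hV, hL⟩
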